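/- **Definitions.** A *restriction monoid* is a monoid $S$ with two unary operations $a\mapsto a^{\ast}$, $a\mapsto a^{+}$ such that, for all $s,t\in S$: (A1) $(s^{\ast})^{\ast}=s^{\ast}$, $(s^{+})^{+}=s^{+}$, $(s^{\ast})^{+}=s^{\ast}$, $(s^{+})^{\ast}=s^{+}$; (A2) $(s^{\ast}t^{\ast})^{\ast}=s^{\ast}t^{\ast}$, $(s^{+}t^{+})^{+}=s^{+}t^{+}$; (A3) $s^{\ast}t^{\ast}=t^{\ast}s^{\ast}$, $s^{+}t^{+}=t^{+}s^{+}$; (A4) $ss^{\ast}=s$, $s^{+}s=s$; (A5) $(st)^{\ast}=(s^{\ast}t)^{\ast}$, $(st)^{+}=(st^{+})^{+}$; (A6) $t^{\ast}s=s(ts)^{\ast}$, $st^{+}=(st^{+})^{+}s$. It is *ample* if moreover (A7): $ac=bc$ implies $ac^{+}=bc^{+}$, and $ca=cb$ implies $c^{\ast}a=c^{\ast}b$. The elements of the form $a^{\ast}$ or $a^{+}$ are the *projections* (in an ample monoid these are exactly the idempotents). The *natural partial order* is $a\le b$ iff $a=ba^{\ast}$, and $a,b$ are *compatible* iff $ab^{\ast}=ba^{\ast}$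 and $a^{+}b=b^{+}a$. A *Boolean ample monoid* is an ample monoid with zero in which every compatible pair of elements has a join in the natural partial order, multiplication distributes over such joins from both sides, and the projections form a Boolean algebra under $\le$ whose bottom element is the zero of the monoid. A *Boolean inverse monoid* is an inverse monoid with zero, with natural partial order $a\le b$ iff $a=ba^{-1}a$, in which every compatible pair $a,b$ (that is, $a^{-1}b$ and $ab^{-1}$ are idempotents) has a join, multiplication distributes over such joins from both sides, and the idempotents form a Boolean algebra under $\le$. Write $\mathsf{E}(S)$ for the set of idempotents of $S$. For a prime filter $F$ of the Boolean algebra $\mathsf{E}(S)$ write $x\le_F y$ iff $x^{\ast},y^{\ast}\in F$ and $x\le y$. *Condition (C)* for a Boolean ample monoid $S$: for every prime filter $F\subseteq\mathsf{E}(S)$ and all $a,b\in S$ with $a^{\ast}b^{\ast}\in F$ there are non-zero $c,d\in S$ such that 1. there is $a_1\le_F a$ with $a_1^{+}\le c^{\ast}$, and there is $b_1\le_F b$ with $b_1^{+}\le d^{\ast}$; 2. there is $e\in F$ with $cae=dbe$. **Theorem.** Let $S$ be a Boolean ample monoid that satisfies condition (C). Then there are a Boolean inverse monoid $T$ and an injective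 monoid homomorphism $\iota\colon S\to T$ whose image contains every idempotent of $T$ (so $S$ is embedded as a full submonoid of $T$), such that every non-zero element of $T$ is the join of a finite set of elements of the form $\iota(a)^{-1}\iota(b)$ with $a,b\in S$. -/

import Mathlib

universe u

namespace AmpleMonoid

/-- `t` is the join (least upper bound) of `X` with respect to the relation `le`. -/
def IsJoin {α : Type*} (le : α → α → Prop) (X : Set α) (t : α) : Prop :=
  (∀ x ∈ X, le x t) ∧ ∀ u, (∀ x ∈ X, le x u) → le t u

/-! ### Restriction monoids and ample monoids -/

/-- A restriction monoid: a monoid with two unary operations `a ↦ a*` (written `rproj a`)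
and `a ↦ a⁺` (written `lproj a`) that satisfy (A1)-(A6). -/
class RestrictionMonoid (S : Type*) extends Monoid S where
  /-- The operation `a ↦ a*`. -/
  rproj : S → S
  /-- The operation `a ↦ a⁺`. -/
  lproj : S → S
  rproj_rproj : ∀ s, rproj (rproj s) = rproj s
  lproj_lproj : ∀ s, lproj (lproj s) = lproj s
  lproj_rproj : ∀ s, lproj (rproj s) = rproj s
  rproj_lproj : ∀ s, rproj (lproj s) = lproj s
  rproj_mul_rproj : ∀ s t, rproj (rproj s * rproj t) = rproj s * rproj t
  lproj_mul_lproj : ∀ s t, lproj (lproj s * lproj t) = lproj s * lproj t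
  rproj_comm : ∀ s t, rproj s * rproj t = rproj t * rproj s
  lproj_comm : ∀ s t, lproj s * lproj t = lproj t * lproj s
  mul_rproj_self : ∀ s, s * rproj s = s
  lproj_mul_self : ∀ s, lproj s * s = s
  rproj_mul : ∀ s t, rproj (s * t) = rproj (rproj s * t)
  lproj_mul : ∀ s t, lproj (s * t) = lproj (s * lproj t)
  rproj_mul_eq : ∀ s t, rproj t * s = s * rproj (t * s)
  mul_lproj_eq : ∀ s t, s * lproj t = lproj (s * lproj t) * s

open RestrictionMonoid (rproj lproj)

section Restriction

variable {S : Type*} [RestrictionMonoid S]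

/-- The natural partial order: `a ≤ b` iff `a = b a*`. -/
def NatLE (a b : S) : Prop := a = b * rproj a

/-- Compatibility: `a ~ b` iff `a b* = b a*` and `a⁺ b = b⁺ a`. -/
def Compatible (a b : S) : Prop := a * rproj b = b * rproj a ∧ lproj a * b = lproj b * a

variable (S) in
/-- The set of projections, i.e. of the elements of the form `a*` or `a⁺`. -/
def Proj : Set S := {e | ∃ a : S, e = rproj a ∨ e = lproj a}

end Restriction

/-- A Boolean restriction monoid: a restriction monoid with zero in which compatible pairs have
joins, multiplication distributes over these joins from both sides, and the projections form
a Boolean algebra under the natural partial order (with the zero of the monoid as bottom). -/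
class BooleanRestrictionMonoid (S : Type*) extends RestrictionMonoid S, MonoidWithZero S where
  zero_mem_proj : (0 : S) ∈ Proj S
  exists_join : ∀ a b : S, Compatible a b → ∃ j, IsJoin NatLE {a, b} j
  mul_join : ∀ c a b j : S, Compatible a b → IsJoin NatLE {a, b} j →
    IsJoin NatLE {c * a, c * b} (c * j)
  join_mul : ∀ c a b j : S, Compatible a b → IsJoin NatLE {a, b} j →
    IsJoin NatLE {a * c, b * c} (j * c)
  proj_boolean : ∃ B : BooleanAlgebra (Proj S),
    ∀ e f : Proj S, B.le e f ↔ NatLE (e : S) (f : S)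

/-- A Boolean ample monoid: a Boolean restriction monoid that is ample, i.e. satisfies (A7). -/
class BooleanAmpleMonoid (S : Type*) extends BooleanRestrictionMonoid S where
  mul_lproj_eq_of_mul_eq : ∀ a b c : S, a * c = b * c → a * lproj c = b * lproj c
  rproj_mul_eq_of_mul_eq : ∀ a b c : S, c * a = c * b → rproj c * a = rproj c * b

section ConditionC

variable {S : Type*} [BooleanAmpleMonoid S]

/-- `F` is a prime filter in the Boolean algebra `E(S)` of idempotents of `S`, in which the meet
is the product. -/
structure IsPrimeFilter (F : Set S) : Prop where
  subset_idempotents : ∀ e ∈ F, IsIdempotentElem e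
  one_mem : (1 : S) ∈ F
  mul_mem : ∀ e ∈ F, ∀ f ∈ F, e * f ∈ F
  mem_of_le : ∀ e ∈ F, ∀ f : S, IsIdempotentElem f → NatLE e f → f ∈ F
  zero_notMem : (0 : S) ∉ F
  mem_or_mem : ∀ e f g : S, IsIdempotentElem e → IsIdempotentElem f →
    IsJoin NatLE {e, f} g → g ∈ F → e ∈ F ∨ f ∈ F

/-- The natural partial order relativized to `F`. -/
def NatLERel (F : Set S) (x y : S) : Prop := rproj x ∈ F ∧ rproj y ∈ F ∧ NatLE x y

variable (S) in
/-- Condition (C). -/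
def ConditionC : Prop :=
  ∀ F : Set S, IsPrimeFilter F → ∀ a b : S, rproj a * rproj b ∈ F →
    ∃ c d : S, c ≠ 0 ∧ d ≠ 0 ∧
      (∃ a₁, NatLERel F a₁ a ∧ NatLE (lproj a₁) (rproj c)) ∧
      (∃ b₁, NatLERel F b₁ b ∧ NatLE (lproj b₁) (rproj d)) ∧
      ∃ e ∈ F, c * a * e = d * b * e

end ConditionC

/-! ### Boolean inverse monoids -/

/-- An inverse monoid: every `a` has a unique generalized inverse `a⁻¹`. -/
class InverseMonoid (T : Type*) extends Monoid T, Inv T where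
  mul_inv_mul : ∀ a : T, a * a⁻¹ * a = a
  inv_mul_inv : ∀ a : T, a⁻¹ * a * a⁻¹ = a⁻¹
  inv_unique : ∀ a b : T, a * b * a = a → b * a * b = b → b = a⁻¹

section Inverse

variable {T : Type*} [InverseMonoid T]

/-- The natural partial order of an inverse monoid: `a ≤ b` iff `a = b a⁻¹ a`. -/
def InvLE (a b : T) : Prop := a = b * (a⁻¹ * a)

/-- Compatibility in an inverse monoid: `a⁻¹ b` and `a b⁻¹` are idempotents. -/
def InvCompatible (a b : T) : Prop := IsIdempotentElem (a⁻¹ * b) ∧ IsIdempotentElem (a * b⁻¹)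

end Inverse

/-- A Boolean inverse monoid: an inverse monoid with zero in which compatible pairs have joins,
multiplication distributes over these joins from both sides, and the idempotents form
a Boolean algebra under the natural partial order. -/
class BooleanInverseMonoid (T : Type*) extends InverseMonoid T, MonoidWithZero T where
  exists_join : ∀ a b : T, InvCompatible a b → ∃ j, IsJoin InvLE {a, b} j
  mul_join : ∀ c a b j : T, InvCompatible a b → IsJoin InvLE {a, b} j →
    IsJoin InvLE {c * a, c * b} (c * j)
  join_mul : ∀ c a b j : T, InvCompatible a b → IsJoin InvLE {a, b} j →
    IsJoin InvLE {a * c, b * c} (j * c)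
  idempotents_boolean : ∃ B : BooleanAlgebra {e : T // IsIdempotentElem e},
    ∀ e f : {e : T // IsIdempotentElem e}, B.le e f ↔ InvLE (e : T) (f : T)

/-- A full embedding of monoids: an injective homomorphism whose image contains every idempotent
of the codomain. -/
def IsFullEmbedding {S T : Type*} [Monoid S] [Monoid T] (ι : S →* T) : Prop :=
  Function.Injective ι ∧ ∀ e : T, IsIdempotentElem e → e ∈ Set.range ι

end AmpleMonoid

namespace AmpleMonoid

open RestrictionMonoid (rproj lproj)

/-! `S` acts by partial injections on the prime filters (points) of its projections: `s` is defined
at `x` when `s* ∈ x`, and its image consists of the `e` with `(es)* ∈ x`. The germs of this action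
form a category with the points as objects. Axiom (A7) makes every germ both epi and mono, and
condition (C) completes every span of germs to a commutative square. So the category of germs maps
faithfully to a groupoid, obtained by inverting all arrows.

`T` consists of the bisections that are finite unions of sets `s⁻¹t` of arrows of this groupoid, and
`ι` sends `s` to the set of its germs. Order, join and inverse in `T` are inclusion, union and
inversion of arrows.

What remains is compactness of the Stone space, in the form `Point.induction_of_local`. It yields
three facts. A product `bc⁻¹` is locally `p⁻¹q` by the Ore condition, hence a finite union of
fractions (`isFiniteUnion_slice_mul_slice_inv`), so `T` is closed under products. Elements with
equal germs are equal (`mul_eq_mul_of_local`), so `ι` is injective. A fraction inside the identities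
is the image of a projection (`exists_fraction_eq_slice`), so `ι` is full and the idempotents of `T`
inherit the Boolean structure. -/

theorem IsJoin.unique {α : Type*} {le : α → α → Prop} (h : ∀ a b, le a b → le b a → a = b)
    {X : Set α} {s t : α} (hs : IsJoin le X s) (ht : IsJoin le X t) : s = t :=
  h _ _ (hs.2 _ ht.1) (ht.2 _ hs.1)

theorem IsJoin.left {α : Type*} {le : α → α → Prop} {a b j : α} (h : IsJoin le {a, b} j) :
    le a j := h.1 _ (Or.inl rfl)

theorem IsJoin.right {α : Type*} {le : α → α → Prop} {a b j : α} (h : IsJoin le {a, b} j) :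
    le b j := h.1 _ (Or.inr rfl)

theorem IsJoin.le_of_le {α : Type*} {le : α → α → Prop} {a b j u : α} (h : IsJoin le {a, b} j)
    (ha : le a u) (hb : le b u) : le j u :=
  h.2 u fun x hx => by rcases hx with rfl | rfl <;> assumption

/-! ### Projections and the natural order. -/

section Restriction

variable {S : Type*} [RestrictionMonoid S]

/-- `e` is a projection. -/
def IsProj (e : S) : Prop := rproj e = e

theorem isProj_rproj (s : S) : IsProj (rproj s) := RestrictionMonoid.rproj_rproj s

theorem isProj_lproj (s : S) : IsProj (lproj s) := RestrictionMonoid.rproj_lproj s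

theorem isProj_of_mem_proj {e : S} (h : e ∈ Proj S) : IsProj e := by
  obtain ⟨a, rfl | rfl⟩ := h
  exacts [isProj_rproj a, isProj_lproj a]

theorem IsProj.mem_proj {e : S} (h : IsProj e) : e ∈ Proj S := ⟨e, Or.inl h.symm⟩

theorem IsProj.rproj_eq {e : S} (h : IsProj e) : rproj e = e := h

theorem IsProj.lproj_eq {e : S} (h : IsProj e) : lproj e = e := by
  rw [← h.rproj_eq, RestrictionMonoid.lproj_rproj]

theorem IsProj.mul {e f : S} (he : IsProj e) (hf : IsProj f) : IsProj (e * f) := by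
  rw [← he.rproj_eq, ← hf.rproj_eq]
  exact RestrictionMonoid.rproj_mul_rproj e f

theorem IsProj.comm {e f : S} (he : IsProj e) (hf : IsProj f) : e * f = f * e := by
  rw [← he.rproj_eq, ← hf.rproj_eq]
  exact RestrictionMonoid.rproj_comm e f

theorem IsProj.mul_self {e : S} (he : IsProj e) : e * e = e := by
  have := RestrictionMonoid.mul_rproj_self e
  rwa [he.rproj_eq] at this

theorem isProj_one : IsProj (1 : S) := by
  have := RestrictionMonoid.mul_rproj_self (1 : S)
  rwa [one_mul] at this

theorem rproj_mul_proj (s : S) {e : S} (he : IsProj e) : rproj (s * e) = rproj s * e := by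
  rw [RestrictionMonoid.rproj_mul, ((isProj_rproj s).mul he).rproj_eq]

theorem lproj_proj_mul (s : S) {e : S} (he : IsProj e) : lproj (e * s) = e * lproj s := by
  rw [RestrictionMonoid.lproj_mul, (he.mul (isProj_lproj s)).lproj_eq]

theorem proj_mul (s : S) {e : S} (he : IsProj e) : e * s = s * rproj (e * s) := by
  have := RestrictionMonoid.rproj_mul_eq s e
  rwa [he.rproj_eq] at this

theorem mul_proj (s : S) {e : S} (he : IsProj e) : s * e = lproj (s * e) * s := by
  have := RestrictionMonoid.mul_lproj_eq s e
  rwa [he.lproj_eq] at this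

theorem rproj_mul_mul_rproj (s t : S) : rproj (s * t) * rproj t = rproj (s * t) := by
  rw [← rproj_mul_proj _ (isProj_rproj t), mul_assoc, RestrictionMonoid.mul_rproj_self]

theorem rproj_mul_comm (s t : S) : rproj s * rproj t = rproj t * rproj s :=
  RestrictionMonoid.rproj_comm s t

theorem NatLE.rproj {a b : S} (h : NatLE a b) : rproj a = rproj b * rproj a := by
  have := congrArg RestrictionMonoid.rproj h
  rwa [rproj_mul_proj _ (isProj_rproj a)] at this

theorem NatLE.antisymm {a b : S} (h : NatLE a b) (h' : NatLE b a) : a = b := by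
  have e : RestrictionMonoid.rproj a = RestrictionMonoid.rproj b := by
    rw [h.rproj, rproj_mul_comm, ← h'.rproj]
  rw [h, e, RestrictionMonoid.mul_rproj_self]

theorem NatLE.eq_lproj_mul {a b : S} (h : NatLE a b) : a = lproj a * b := by
  have := mul_proj b (isProj_rproj a)
  rwa [← h] at this

theorem NatLE.lproj {a b : S} (h : NatLE a b) : lproj a = lproj a * lproj b := by
  have := congrArg RestrictionMonoid.lproj h.eq_lproj_mul
  rwa [lproj_proj_mul _ (isProj_lproj a)] at this

theorem IsProj.natLE_iff {e b : S} (he : IsProj e) : NatLE e b ↔ e = b * e := by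
  rw [NatLE, he.rproj_eq]

theorem IsProj.compatible {e f : S} (he : IsProj e) (hf : IsProj f) : Compatible e f := by
  rw [Compatible, he.rproj_eq, hf.rproj_eq, he.lproj_eq, hf.lproj_eq]
  exact ⟨he.comm hf, he.comm hf⟩

theorem isProj_of_natLE_one {a : S} (h : NatLE a 1) : IsProj a := by
  have := h
  rw [NatLE, one_mul] at this
  exact this.symm

theorem IsProj.isProj_join {e f g : S} (he : IsProj e) (hf : IsProj f)
    (h : IsJoin NatLE {e, f} g) : IsProj g :=
  isProj_of_natLE_one (h.le_of_le (he.natLE_iff.2 (one_mul e).symm)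
    (hf.natLE_iff.2 (one_mul f).symm))

end Restriction

/-! ### Joins, points and the partial action on points. -/

section Boolean

variable {S : Type*} [BooleanRestrictionMonoid S]

theorem isProj_zero : IsProj (0 : S) := isProj_of_mem_proj BooleanRestrictionMonoid.zero_mem_proj

theorem IsProj.exists_join {e f : S} (he : IsProj e) (hf : IsProj f) :
    ∃ g, IsProj g ∧ IsJoin NatLE {e, f} g := by
  obtain ⟨g, hg⟩ := BooleanRestrictionMonoid.exists_join e f (he.compatible hf)
  exact ⟨g, he.isProj_join hf hg, hg⟩

theorem IsProj.mul_join {e f g : S} (he : IsProj e) (hf : IsProj f)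
    (h : IsJoin NatLE {e, f} g) (s : S) : IsJoin NatLE {s * e, s * f} (s * g) :=
  BooleanRestrictionMonoid.mul_join s e f g (he.compatible hf) h

theorem IsProj.join_mul {e f g : S} (he : IsProj e) (hf : IsProj f)
    (h : IsJoin NatLE {e, f} g) (s : S) : IsJoin NatLE {e * s, f * s} (g * s) :=
  BooleanRestrictionMonoid.join_mul s e f g (he.compatible hf) h

/-- Let `k` be the join of `a*` and `b*`. Distributivity makes `jk` the join of `ja* = a` and `jb* =
b`, so `jk = j` and `j* ≤ k`. This keeps images of points prime. -/
theorem isJoin_rproj {a b j : S} (h : IsJoin NatLE {a, b} j) :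
    IsJoin NatLE {rproj a, rproj b} (rproj j) := by
  obtain ⟨k, hk, hj⟩ := (isProj_rproj a).exists_join (isProj_rproj b)
  have h1 := (isProj_rproj a).mul_join (isProj_rproj b) hj j
  rw [← show a = j * rproj a from h.left, ← show b = j * rproj b from h.right] at h1
  have h2 : j * k = j := h1.unique (fun _ _ => NatLE.antisymm) h
  have h3 : NatLE k (rproj j) :=
    hj.le_of_le ((isProj_rproj a).natLE_iff.2 h.left.rproj)
      ((isProj_rproj b).natLE_iff.2 h.right.rproj)
  rw [hk.natLE_iff, ← rproj_mul_proj _ hk, h2] at h3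
  rwa [← h3]

theorem isJoin_lproj {a b j : S} (h : IsJoin NatLE {a, b} j) :
    IsJoin NatLE {lproj a, lproj b} (lproj j) := by
  obtain ⟨k, hk, hj⟩ := (isProj_lproj a).exists_join (isProj_lproj b)
  have h1 := (isProj_lproj a).join_mul (isProj_lproj b) hj j
  rw [← h.left.eq_lproj_mul, ← h.right.eq_lproj_mul] at h1
  have h2 : k * j = j := h1.unique (fun _ _ => NatLE.antisymm) h
  have h3 : NatLE k (lproj j) :=
    hj.le_of_le ((isProj_lproj a).natLE_iff.2 (h.left.lproj.trans
        ((isProj_lproj a).comm (isProj_lproj j))))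
      ((isProj_lproj b).natLE_iff.2 (h.right.lproj.trans
        ((isProj_lproj b).comm (isProj_lproj j))))
  rw [hk.natLE_iff, (isProj_lproj j).comm hk, ← lproj_proj_mul _ hk, h2] at h3
  rwa [← h3]

variable (S) in
/-- A point of the Stone space of the projections, extended to all elements `s` by the
convention that `s` belongs to it if and only if `s*` does. -/
@[ext]
structure Point where
  carrier : Set S
  rproj_mem_iff' : ∀ s, rproj s ∈ carrier ↔ s ∈ carrier
  one_mem' : 1 ∈ carrier
  zero_notMem' : 0 ∉ carrier
  mul_mem_iff' : ∀ e f, IsProj e → IsProj f → (e * f ∈ carrier ↔ e ∈ carrier ∧ f ∈ carrier)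
  mem_or_mem' : ∀ e f g, IsProj e → IsProj f → IsJoin NatLE {e, f} g → g ∈ carrier →
    e ∈ carrier ∨ f ∈ carrier

instance : SetLike (Point S) S where
  coe := Point.carrier
  coe_injective _ _ h := Point.ext h

namespace Point

variable (x y : Point S)

theorem rproj_mem_iff {s : S} : rproj s ∈ x ↔ s ∈ x := x.rproj_mem_iff' s

theorem one_mem : 1 ∈ x := x.one_mem'

theorem zero_notMem : 0 ∉ x := x.zero_notMem'

theorem mem_or_mem {e f g : S} (he : IsProj e) (hf : IsProj f) (h : IsJoin NatLE {e, f} g)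
    (hg : g ∈ x) : e ∈ x ∨ f ∈ x := x.mem_or_mem' e f g he hf h hg

theorem mul_mem_iff {s e : S} (he : IsProj e) : s * e ∈ x ↔ s ∈ x ∧ e ∈ x := by
  rw [← x.rproj_mem_iff, rproj_mul_proj _ he, ← x.rproj_mem_iff (s := s)]
  exact x.mul_mem_iff' _ _ (isProj_rproj s) he

theorem mem_of_mul_mem {s t : S} (h : s * t ∈ x) : t ∈ x := by
  rw [← x.rproj_mem_iff, ← rproj_mul_mul_rproj, x.mul_mem_iff (isProj_rproj t)] at h
  exact x.rproj_mem_iff.1 h.2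

theorem mem_of_natLE {s t : S} (h : NatLE s t) (hs : s ∈ x) : t ∈ x := by
  rw [h, x.mul_mem_iff (isProj_rproj s)] at hs
  exact hs.1

theorem rproj_mul_mem_iff {s t : S} : rproj s * t ∈ x ↔ s * t ∈ x := by
  rw [← x.rproj_mem_iff, ← RestrictionMonoid.rproj_mul, x.rproj_mem_iff]

theorem mul_mem_of_mem_iff {s t e : S} (he : IsProj e) (hx : e ∈ x) (h : s * e = t * e) (u : S) :
    u * s ∈ x ↔ u * t ∈ x := by
  have h1 : u * s ∈ x ↔ u * s * e ∈ x := by simp [x.mul_mem_iff he, hx]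
  have h2 : u * t ∈ x ↔ u * t * e ∈ x := by simp [x.mul_mem_iff he, hx]
  rw [h1, h2, mul_assoc, h, mul_assoc]

/-- The image of a point under the partial action of `S`. -/
def act (s : S) (x : Point S) (hs : s ∈ x) : Point S where
  carrier := {t | t * s ∈ x}
  rproj_mem_iff' _ := x.rproj_mul_mem_iff
  one_mem' := by simpa using hs
  zero_notMem' := by simpa using x.zero_notMem
  mul_mem_iff' e f he hf := by
    change e * f * s ∈ x ↔ e * s ∈ x ∧ f * s ∈ x
    rw [mul_assoc, proj_mul s hf, ← mul_assoc, x.mul_mem_iff (isProj_rproj _), x.rproj_mem_iff,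
      ← proj_mul s hf]
  mem_or_mem' e f g he hf h hg := by
    have := isJoin_rproj (he.join_mul hf h s)
    change e * s ∈ x ∨ f * s ∈ x
    simpa only [x.rproj_mem_iff] using x.mem_or_mem (isProj_rproj _) (isProj_rproj _) this
      (x.rproj_mem_iff.2 hg)

@[simp]
theorem mem_act {s t : S} {x : Point S} (hs : s ∈ x) : t ∈ act s x hs ↔ t * s ∈ x := Iff.rfl

/-- By (A6), `se = (se)⁺s`, so `(se)⁺` can be pulled out. Hence preimages of points are closed under
meets. -/
theorem lproj_mul_mul_proj (s : S) {e : S} (he : IsProj e) (f : S) :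
    lproj (s * (e * f)) = lproj (s * e) * lproj (s * f) := by
  rw [← lproj_proj_mul _ (isProj_lproj _), ← mul_assoc, ← mul_assoc, ← mul_proj s he]

/-- The preimage of a point under the partial action of `S`. -/
def coact (s : S) (y : Point S) (hs : lproj s ∈ y) : Point S where
  carrier := {t | lproj (s * rproj t) ∈ y}
  rproj_mem_iff' t := by simp [RestrictionMonoid.rproj_rproj]
  one_mem' := by simpa [isProj_one.rproj_eq] using hs
  zero_notMem' := by
    simpa [isProj_zero.rproj_eq, isProj_zero.lproj_eq] using y.zero_notMem
  mul_mem_iff' e f he hf := by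
    change lproj (s * rproj (e * f)) ∈ y ↔ lproj (s * rproj e) ∈ y ∧ lproj (s * rproj f) ∈ y
    rw [(he.mul hf).rproj_eq, he.rproj_eq, hf.rproj_eq, lproj_mul_mul_proj s he f,
      y.mul_mem_iff (isProj_lproj _)]
  mem_or_mem' e f g he hf h hg := by
    have h1 := isJoin_lproj (he.mul_join hf h s)
    change lproj (s * rproj g) ∈ y at hg
    change lproj (s * rproj e) ∈ y ∨ lproj (s * rproj f) ∈ y
    rw [(he.isProj_join hf h).rproj_eq] at hg
    rw [he.rproj_eq, hf.rproj_eq]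
    exact y.mem_or_mem (isProj_lproj _) (isProj_lproj _) h1 hg

/-- By (A6), `s(ts)* = t*s`, whose left projection is `t*s⁺`. So `coact s` followed by `act s` is
the identity. -/
theorem mul_mem_coact_iff {s t : S} {y : Point S} (hs : lproj s ∈ y) :
    t * s ∈ coact s y hs ↔ t ∈ y := by
  change lproj (s * rproj (t * s)) ∈ y ↔ _
  rw [RestrictionMonoid.rproj_mul t s, ← proj_mul s (isProj_rproj t),
    lproj_proj_mul _ (isProj_rproj t), y.mul_mem_iff (isProj_lproj s), y.rproj_mem_iff]
  simp [hs]

/-- A property of projections that is stable under passing to smaller projections and under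
joins, and that holds locally at every point of `e`, holds for `e`. -/
theorem induction_of_local (I : S → Prop) (h0 : I 0)
    (hmul : ∀ e f, IsProj e → IsProj f → I e → I (e * f))
    (hjoin : ∀ e f g, IsProj e → IsProj f → IsJoin NatLE {e, f} g → I e → I f → I g)
    {e : S} (he : IsProj e) (hloc : ∀ x : Point S, e ∈ x → ∃ f, IsProj f ∧ f ∈ x ∧ I f) : I e := by
  obtain ⟨B, hB⟩ := BooleanRestrictionMonoid.proj_boolean (S := S)
  let := B
  have hB' : ∀ a b : Proj S, a ≤ b ↔ (a : S) = b * a := fun a b =>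
    (hB a b).trans (isProj_of_mem_proj a.2).natLE_iff
  have hP : ∀ a : Proj S, IsProj (a : S) := fun a => isProj_of_mem_proj a.2
  have hsup : ∀ (a b : Proj S) (g : S) (hg : IsJoin NatLE {(a : S), (b : S)} g),
      g = ((a ⊔ b : Proj S) : S) := by
    intro a b g hg
    apply NatLE.antisymm
    · exact hg.le_of_le ((hB _ _).1 le_sup_left) ((hB _ _).1 le_sup_right)
    · have := (hB (a ⊔ b) ⟨g, ((hP a).isProj_join (hP b) hg).mem_proj⟩).1
        (sup_le ((hB _ _).2 hg.left) ((hB _ _).2 hg.right))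
      exact this
  -- The projections with property `I` form an ideal. If `e` lies outside it, some prime ideal `K ⊇
  -- J` avoids `e`, and the complement of `K` is a point containing `e` at which the local
  -- hypothesis fails.
  let J : Order.Ideal (Proj S) := Order.IsIdeal.toIdeal (I := {a : Proj S | I a})
    { IsLowerSet := by
        intro a b hba ha
        change I b
        rw [(hB' b a).1 hba]
        exact hmul _ _ (hP a) (hP b) ha
      Nonempty := ⟨⟨0, isProj_zero.mem_proj⟩, h0⟩
      Directed := by
        intro a ha b hb
        obtain ⟨g, hg, hj⟩ := (hP a).exists_join (hP b)
        refine ⟨a ⊔ b, ?_, le_sup_left, le_sup_right⟩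
        change I _
        rw [← hsup a b g hj]
        exact hjoin _ _ g (hP a) (hP b) hj ha hb }
  by_contra hI
  let e' : Proj S := ⟨e, he.mem_proj⟩
  have hdis : Disjoint (Order.PFilter.principal e' : Set (Proj S)) J := by
    rw [Set.disjoint_left]
    intro a ha haJ
    have : e' ≤ a := ha
    exact hI (J.lower this haJ)
  obtain ⟨K, hK, hJK, hdK⟩ := DistribLattice.prime_ideal_of_disjoint_filter_ideal hdis
  have heK : e' ∉ K := Set.disjoint_left.1 hdK (Order.PFilter.mem_principal.2 le_rfl)
  let r : S → Proj S := fun s => ⟨rproj s, (isProj_rproj s).mem_proj⟩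
  have hr : ∀ a : Proj S, r a = a := fun a => Subtype.ext (hP a)
  have hr' : ∀ {s : S} (hs : IsProj s), r s = ⟨s, hs.mem_proj⟩ := fun hs => Subtype.ext hs
  let x : Point S :=
    { carrier := {s | r s ∉ K}
      rproj_mem_iff' := fun s => by
        change r (rproj s) ∉ K ↔ r s ∉ K
        rw [hr' (isProj_rproj s)]
      one_mem' := by
        intro h
        exact heK (K.lower ((hB' _ _).2 (by simp [r, isProj_one.rproj_eq])) h)
      zero_notMem' := by
        intro h
        apply h
        apply hJK
        change I (rproj 0)
        rwa [isProj_zero.rproj_eq]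
      mul_mem_iff' := by
        intro a b ha hb
        change r (a * b) ∉ K ↔ r a ∉ K ∧ r b ∉ K
        rw [hr' ha, hr' hb, hr' (ha.mul hb)]
        constructor
        · intro h
          refine ⟨fun h' => h (K.lower ((hB' _ _).2 ?_) h'),
            fun h' => h (K.lower ((hB' _ _).2 ?_) h')⟩
          · change a * b = a * (a * b)
            rw [← mul_assoc, ha.mul_self]
          · change a * b = b * (a * b)
            rw [ha.comm hb, ← mul_assoc, hb.mul_self]
        · rintro ⟨h1, h2⟩ h
          have : (⟨a, ha.mem_proj⟩ : Proj S) ⊓ ⟨b, hb.mem_proj⟩ ∈ K := by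
            refine K.lower ((hB' _ _).2 ?_) h
            have h3 := (hB' _ _).1 (inf_le_left : (⟨a, ha.mem_proj⟩ : Proj S) ⊓ ⟨b, hb.mem_proj⟩ ≤ _)
            have h4 := (hB' _ _).1 (inf_le_right : (⟨a, ha.mem_proj⟩ : Proj S) ⊓ ⟨b, hb.mem_proj⟩ ≤ _)
            change _ = a * b * _
            rw [mul_assoc, ← h4, ← h3]
          exact (hK.mem_or_mem this).elim h1 h2
      mem_or_mem' := by
        intro a b g ha hb hg hgK
        change r a ∉ K ∨ r b ∉ K
        by_contra! h
        apply hgK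
        rw [hr' ha, hr' hb] at h
        have h1 := Order.Ideal.sup_mem h.1 h.2
        have h2 : r g = ⟨a, ha.mem_proj⟩ ⊔ ⟨b, hb.mem_proj⟩ := by
          rw [hr' (ha.isProj_join hb hg)]
          exact Subtype.ext (hsup _ _ g hg)
        rwa [h2] }
  have hex : e ∈ x := by
    change r e ∉ K
    rwa [hr' he]
  obtain ⟨f, hf, hfx, hfI⟩ := hloc x hex
  have : r f ∉ K := hfx
  rw [hr' hf] at this
  exact this (hJK hfI)

end Point

end Boolean

/-! ### Idempotents and prime filters in an ample monoid. -/

section Ample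

variable {S : Type*} [BooleanAmpleMonoid S]

/-- Applying (A7) to `e·e = 1·e` and `e·e = e·1` gives `ee⁺ = e⁺` and `e*e = e*`. Then `e*e⁺` equals
both `e*` and `e⁺`, so `e = ee* = ee⁺ = e⁺`. -/
theorem isProj_iff_isIdempotentElem {e : S} : IsProj e ↔ IsIdempotentElem e := by
  refine ⟨fun h => h.mul_self, fun h => ?_⟩
  have h1 : e * lproj e = lproj e := by
    simpa using BooleanAmpleMonoid.mul_lproj_eq_of_mul_eq e 1 e (by rw [h.eq, one_mul])
  have h2 : rproj e * e = rproj e := by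
    simpa using BooleanAmpleMonoid.rproj_mul_eq_of_mul_eq e 1 e (by rw [h.eq, mul_one])
  have h3 : rproj e * lproj e = lproj e := by
    rw [← rproj_mul_proj _ (isProj_lproj e), h1, (isProj_lproj e).rproj_eq]
  have h4 : rproj e * lproj e = rproj e := by
    rw [← lproj_proj_mul _ (isProj_rproj e), h2, (isProj_rproj e).lproj_eq]
  rw [IsProj, ← RestrictionMonoid.mul_rproj_self e, ← h4, h3, h1, (isProj_lproj e).rproj_eq]

theorem Point.isPrimeFilter (x : Point S) : IsPrimeFilter {e : S | e ∈ x ∧ IsProj e} where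
  subset_idempotents e he := isProj_iff_isIdempotentElem.1 he.2
  one_mem := ⟨x.one_mem, isProj_one⟩
  mul_mem e he f hf := ⟨(x.mul_mem_iff hf.2).2 ⟨he.1, hf.1⟩, he.2.mul hf.2⟩
  mem_of_le e he f hf hle :=
    ⟨x.mem_of_natLE hle he.1, isProj_iff_isIdempotentElem.2 hf⟩
  zero_notMem h := x.zero_notMem h.1
  mem_or_mem e f g he hf hg hgx := by
    rw [← isProj_iff_isIdempotentElem] at he hf
    exact (x.mem_or_mem he hf hg hgx.1).imp (fun h => ⟨h, he⟩) fun h => ⟨h, hf⟩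

end Ample

open CategoryTheory

/-! ### The category of germs. -/

section Germs

variable {S : Type u} [BooleanRestrictionMonoid S]

namespace Point

/-- `s` maps the point `x` to the point `y`. -/
def Maps (s : S) (x y : Point S) : Prop := ∀ t, t ∈ y ↔ t * s ∈ x

theorem Maps.mem {s : S} {x y : Point S} (h : Maps s x y) : s ∈ x := by
  simpa using (h 1).1 y.one_mem

theorem maps_act {s : S} {x : Point S} (hs : s ∈ x) : Maps s x (act s x hs) := fun _ => Iff.rfl

theorem maps_coact {s : S} {y : Point S} (hs : lproj s ∈ y) : Maps s (coact s y hs) y :=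
  fun _ => (mul_mem_coact_iff hs).symm

theorem Maps.comp {s t : S} {x y z : Point S} (hs : Maps s x y) (ht : Maps t y z) :
    Maps (t * s) x z := fun u => by rw [ht, hs, mul_assoc]

theorem maps_one (x : Point S) : Maps 1 x x := fun t => by rw [mul_one]

theorem Maps.unique {s : S} {x y y' : Point S} (h : Maps s x y) (h' : Maps s x y') : y = y' :=
  SetLike.ext fun t => (h t).trans (h' t).symm

theorem Maps.of_natLE {s t : S} (hle : NatLE s t) {x y : Point S} (h : Maps s x y) :
    Maps t x y := by
  intro u
  rw [h u, mul_mem_of_mem_iff x (isProj_rproj s) (x.rproj_mem_iff.2 h.mem)]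
  rw [RestrictionMonoid.mul_rproj_self, ← show s = t * rproj s from hle]

theorem Maps.lproj_mem {s : S} {x y : Point S} (h : Maps s x y) : lproj s ∈ y := by
  rw [h, RestrictionMonoid.lproj_mul_self]
  exact h.mem

/-- Since `(se)⁺s = se`, the source can be read off from the target; hence the action is injective.
-/
theorem Maps.proj_mem_iff {s e : S} (he : IsProj e) {x y : Point S} (h : Maps s x y) :
    e ∈ x ↔ lproj (s * e) ∈ y := by
  rw [h, ← AmpleMonoid.mul_proj s he, x.mul_mem_iff he]
  simp [h.mem]

theorem Maps.injective {s : S} {x x' y : Point S} (h : Maps s x y) (h' : Maps s x' y) :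
    x = x' := by
  ext t
  change t ∈ x ↔ t ∈ x'
  rw [← x.rproj_mem_iff, ← x'.rproj_mem_iff, h.proj_mem_iff (isProj_rproj t),
    h'.proj_mem_iff (isProj_rproj t)]

theorem maps_proj_iff {e : S} (he : IsProj e) {x y : Point S} : Maps e x y ↔ e ∈ x ∧ x = y := by
  constructor
  · intro h
    have h' : Maps e x x := fun t => by
      rw [x.mul_mem_iff he]
      simp [h.mem]
    exact ⟨h.mem, h'.unique h⟩
  · rintro ⟨h, rfl⟩ t
    rw [x.mul_mem_iff he]
    simp [h]

/-- `s` and `t` have the same germ at the point `x`. -/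
def GermEq (x : Point S) (s t : S) : Prop := ∃ e ∈ x, IsProj e ∧ s * e = t * e

theorem GermEq.trans {x : Point S} {s t u : S} (h : GermEq x s t) (h' : GermEq x t u) :
    GermEq x s u := by
  obtain ⟨e, hex, he, hst⟩ := h
  obtain ⟨f, hfx, hf, htu⟩ := h'
  refine ⟨e * f, (x.mul_mem_iff hf).2 ⟨hex, hfx⟩, he.mul hf, ?_⟩
  rw [← mul_assoc, hst, mul_assoc, he.comm hf, ← mul_assoc, htu, mul_assoc]

theorem GermEq.mul_left {x : Point S} {s t : S} (h : GermEq x s t) (u : S) :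
    GermEq x (u * s) (u * t) := by
  obtain ⟨e, hex, he, hst⟩ := h
  exact ⟨e, hex, he, by rw [mul_assoc, hst, mul_assoc]⟩

theorem GermEq.mul_right {x y : Point S} {s t u : S} (hu : Maps u x y) (h : GermEq y s t) :
    GermEq x (s * u) (t * u) := by
  obtain ⟨e, hex, he, hst⟩ := h
  -- The neighbourhood `e` of `y` is pulled back along `u` by `eu = u(eu)*`.
  refine ⟨rproj (e * u), x.rproj_mem_iff.2 ((hu e).1 hex), isProj_rproj _, ?_⟩
  rw [mul_assoc, mul_assoc, ← AmpleMonoid.proj_mul u he, ← mul_assoc, hst, mul_assoc]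

theorem Maps.of_germEq {x y : Point S} {s t : S} (hs : Maps s x y) (h : GermEq x s t) :
    Maps t x y := by
  obtain ⟨e, hex, he, hst⟩ := h
  exact fun u => (hs u).trans (x.mul_mem_of_mem_iff he hex hst u)

/-- The setoid whose classes are the germs from `x` to `y`. -/
def germSetoid (x y : Point S) : Setoid {s : S // Maps s x y} where
  r s t := GermEq x s t
  iseqv :=
    { refl := fun _ => ⟨1, x.one_mem, isProj_one, rfl⟩
      symm := fun ⟨e, h, he, h'⟩ => ⟨e, h, he, h'.symm⟩
      trans := GermEq.trans }

instance : Category.{u} (Point S) where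
  Hom x y := Quotient (germSetoid x y)
  id x := Quotient.mk _ ⟨1, maps_one x⟩
  comp {x y z} := Quotient.map₂ (fun s t => ⟨t.1 * s.1, s.2.comp t.2⟩)
    fun s _ hs _ t' ht => (ht.mul_right s.2).trans (hs.mul_left t'.1)
  id_comp := by
    rintro x y ⟨s⟩
    exact congrArg (Quotient.mk _) (Subtype.ext (mul_one _))
  comp_id := by
    rintro x y ⟨s⟩
    exact congrArg (Quotient.mk _) (Subtype.ext (one_mul _))
  assoc := by
    rintro w x y z ⟨s⟩ ⟨t⟩ ⟨u⟩
    exact congrArg (Quotient.mk _) (Subtype.ext (mul_assoc _ _ _).symm)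

/-- The germ of `s` at `x`. -/
def germ (s : S) {x y : Point S} (h : Maps s x y) : x ⟶ y := Quotient.mk (germSetoid x y) ⟨s, h⟩

theorem exists_eq_germ {x y : Point S} (f : x ⟶ y) : ∃ s, ∃ h : Maps s x y, f = germ s h := by
  obtain ⟨s⟩ := f
  exact ⟨s.1, s.2, rfl⟩

theorem germ_eq_iff {s t : S} {x y : Point S} (hs : Maps s x y) (ht : Maps t x y) :
    germ s hs = germ t ht ↔ GermEq x s t := Quotient.eq (r := germSetoid x y)

theorem germ_comp_germ {s t : S} {x y z : Point S} (hs : Maps s x y) (ht : Maps t y z) :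
    germ s hs ≫ germ t ht = germ (t * s) (hs.comp ht) := rfl

theorem germ_one (x : Point S) : germ 1 (maps_one x) = 𝟙 x := rfl

theorem germ_proj {e : S} (he : IsProj e) {x : Point S} (h : Maps e x x) : germ e h = 𝟙 x := by
  rw [← germ_one, germ_eq_iff]
  exact ⟨e, h.mem, he, by rw [he.mul_self, one_mul]⟩

end Point

end Germs

/-! ### Cancellation, the Ore condition and the groupoid of fractions. -/

namespace Point

variable {S : Type u} [BooleanAmpleMonoid S]

/-- From `c(ae) = d(ae)`, (A7) gives `c(ae)⁺ = d(ae)⁺`, and `(ae)⁺` is a neighbourhood of the target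
of `a`. -/
instance epi_germ {x y : Point S} (f : x ⟶ y) : Epi f where
  left_cancellation {z} g h hgh := by
    obtain ⟨a, ha, rfl⟩ := exists_eq_germ f
    obtain ⟨c, hc, rfl⟩ := exists_eq_germ g
    obtain ⟨d, hd, rfl⟩ := exists_eq_germ h
    rw [germ_comp_germ, germ_comp_germ, germ_eq_iff] at hgh
    obtain ⟨e, hex, he, h⟩ := hgh
    rw [germ_eq_iff]
    rw [mul_assoc, mul_assoc] at h
    refine ⟨lproj (a * e), (ha.proj_mem_iff he).1 hex, isProj_lproj _, ?_⟩
    exact BooleanAmpleMonoid.mul_lproj_eq_of_mul_eq _ _ _ h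

instance mono_germ {x y : Point S} (f : x ⟶ y) : Mono f where
  right_cancellation {z} g h hgh := by
    obtain ⟨c, hc, rfl⟩ := exists_eq_germ f
    obtain ⟨a, ha, rfl⟩ := exists_eq_germ g
    obtain ⟨b, hb, rfl⟩ := exists_eq_germ h
    rw [germ_comp_germ, germ_comp_germ, germ_eq_iff] at hgh
    obtain ⟨e, hex, he, h⟩ := hgh
    rw [germ_eq_iff]
    have h1 : rproj (c * a) * e = rproj (c * b) * e := by
      rw [← rproj_mul_proj _ he, h, rproj_mul_proj _ he]
    rw [mul_assoc, mul_assoc] at h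
    have h2 := BooleanAmpleMonoid.rproj_mul_eq_of_mul_eq _ _ _ h
    -- (A7) gives only `c*ae = c*be`. Moving `c*` to the right by (A6) turns it into `(ca)*` and
    -- `(cb)*`, which agree on `e` by `h1`.
    refine ⟨rproj (c * a) * e, (z.mul_mem_iff he).2 ⟨z.rproj_mem_iff.2 (ha.comp hc).mem, hex⟩,
      (isProj_rproj _).mul he, ?_⟩
    rw [RestrictionMonoid.rproj_mul, ← mul_assoc, ← proj_mul a (isProj_rproj c), mul_assoc, h2,
      ← mul_assoc, proj_mul b (isProj_rproj c), ← RestrictionMonoid.rproj_mul,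
      ← RestrictionMonoid.rproj_mul, h1, mul_assoc]

/-- At `x` the restriction `a₁` acts like `a`, so `a₁⁺` lies in `y`, and `c*` is above it. This is
how part 1 of condition (C) makes `c` composable with `a`. -/
theorem exists_maps_of_natLE {a a₁ c : S} {x y : Point S} (ha : Maps a x y) (ha₁ : a₁ ∈ x)
    (hle : NatLE a₁ a) (hc : NatLE (lproj a₁) (rproj c)) : c ∈ y := by
  have h1 : Maps a₁ x (act a₁ x ha₁) := maps_act ha₁
  have h2 : y = act a₁ x ha₁ := ha.unique (h1.of_natLE hle)
  rw [h2, ← Point.rproj_mem_iff]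
  exact mem_of_natLE _ hc h1.lproj_mem

/-- Condition (C) is the left Ore condition for the category of germs. -/
theorem exists_comp_eq_comp (hC : ConditionC S) {x y z : Point S} (f : x ⟶ y) (g : x ⟶ z) :
    ∃ (w : Point S) (p : y ⟶ w) (q : z ⟶ w), f ≫ p = g ≫ q := by
  obtain ⟨a, ha, rfl⟩ := exists_eq_germ f
  obtain ⟨b, hb, rfl⟩ := exists_eq_germ g
  have hab : rproj a * rproj b ∈ {e : S | e ∈ x ∧ IsProj e} :=
    ⟨(x.mul_mem_iff (isProj_rproj b)).2 ⟨x.rproj_mem_iff.2 ha.mem, x.rproj_mem_iff.2 hb.mem⟩,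
      (isProj_rproj a).mul (isProj_rproj b)⟩
  obtain ⟨c, d, -, -, ⟨a₁, ⟨ha₁, -, ha₂⟩, ha₃⟩, ⟨b₁, ⟨hb₁, -, hb₂⟩, hb₃⟩, e, ⟨hex, he⟩, h⟩ :=
    hC _ x.isPrimeFilter a b hab
  have hc : c ∈ y := exists_maps_of_natLE ha (x.rproj_mem_iff.1 ha₁.1) ha₂ ha₃
  have hca := ha.comp (maps_act hc)
  have hdb : Maps (d * b) x (act c y hc) := hca.of_germEq ⟨e, hex, he, h⟩
  have hd : Maps d z (act c y hc) := fun t => by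
    rw [hdb t, hb, mul_assoc]
  refine ⟨_, germ c (maps_act hc), germ d hd, ?_⟩
  rw [germ_comp_germ, germ_comp_germ, germ_eq_iff]
  exact ⟨e, hex, he, h⟩

end Point

/-- A cancellative category that satisfies the left Ore condition has a faithful functor
to a groupoid, namely its groupoid of left fractions. -/
theorem exists_faithful_functor_groupoid {C : Type u} [Category.{u} C]
    (hmono : ∀ {x y : C} (f : x ⟶ y), Mono f) (hepi : ∀ {x y : C} (f : x ⟶ y), Epi f)
    (hore : ∀ {x y z : C} (f : x ⟶ y) (g : x ⟶ z),
      ∃ (w : C) (p : y ⟶ w) (q : z ⟶ w), f ≫ p = g ≫ q) :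
    ∃ (D : Type u) (_ : Groupoid.{u} D) (L : C ⥤ D),
      ∀ {x y : C} (f g : x ⟶ y), L.map f = L.map g → f = g := by
  let W : MorphismProperty C := ⊤
  have : W.HasLeftCalculusOfFractions :=
    { exists_leftFraction := fun x y φ => by
        obtain ⟨w, p, q, h⟩ := hore φ.f φ.s
        exact ⟨⟨q, p, trivial⟩, h⟩
      -- Arrows equalized by `s` are already equal because `s` is epi, so an identity coequalizes
      -- them.
      ext := fun x' x y f₁ f₂ s _ h => by
        have := hepi s
        exact ⟨y, 𝟙 y, trivial, by rw [(cancel_epi s).1 h]⟩ }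
  let L := MorphismProperty.LeftFraction.Localization.Q W
  have hfrac : ∀ {x y : C} (f : L.obj x ⟶ L.obj y), ∃ (z : C) (a : x ⟶ z) (b : y ⟶ z),
      f ≫ L.map b = L.map a := by
    intro x y f
    obtain ⟨φ, rfl⟩ := Localization.exists_leftFraction L W f
    exact ⟨φ.Y', φ.f, φ.s, φ.map_comp_map_s L _⟩
  have hiso : ∀ {x y : C} (f : x ⟶ y), IsIso (L.map f) := fun f =>
    Localization.inverts L W f trivial
  have hiso' : ∀ {x y : C} (f : L.obj x ⟶ L.obj y), IsIso f := by
    intro x y f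
    obtain ⟨z, a, b, h⟩ := hfrac f
    have := hiso a
    have := hiso b
    rw [← IsIso.eq_comp_inv] at h
    rw [h]
    infer_instance
  -- The localization has the same objects as `C`, so `hiso'` covers all its arrows.
  refine ⟨MorphismProperty.LeftFraction.Localization W, Groupoid.ofIsIso fun {x y} f => hiso' (x := x) (y := y) f, L, ?_⟩
  intro x y f g h
  rw [MorphismProperty.map_eq_iff_postcomp L W] at h
  obtain ⟨z, s, -, h⟩ := h
  have := hmono s
  exact (cancel_mono s).1 h

/-! ### Sets of arrows of a groupoid and their bisections. -/

section ArrowSet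

variable {X D : Type*} [Groupoid D]

/-- Sets of arrows between objects of the form `L x`. -/
def ArrowSet (L : X → D) := ∀ x y : X, Set (L x ⟶ L y)

namespace ArrowSet

variable {L : X → D}

instance : CompleteLattice (ArrowSet L) :=
  inferInstanceAs (CompleteLattice (∀ x y : X, Set (L x ⟶ L y)))

@[ext]
theorem ext {A B : ArrowSet L} (h : ∀ x y f, f ∈ A x y ↔ f ∈ B x y) : A = B :=
  funext fun x => funext fun y => Set.ext fun f => h x y f

theorem mem_sup {A B : ArrowSet L} {x y : X} {f : L x ⟶ L y} :
    f ∈ (A ⊔ B) x y ↔ f ∈ A x y ∨ f ∈ B x y := Iff.rfl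

theorem notMem_bot {x y : X} (f : L x ⟶ L y) : f ∉ (⊥ : ArrowSet L) x y := fun h => h

/-- The right factor acts first, as for the action of `S` on points. -/
instance : Mul (ArrowSet L) :=
  ⟨fun A B x z => {h | ∃ y, ∃ f ∈ B x y, ∃ g ∈ A y z, f ≫ g = h}⟩

/-- Identities require `x = y`, not just `L x = L y`, so `L` need not be injective on objects. -/
instance : One (ArrowSet L) := ⟨fun x y => {f | ∃ h : x = y, f = eqToHom (congrArg L h)}⟩

instance : Inv (ArrowSet L) := ⟨fun A x y => {f | Groupoid.inv f ∈ A y x}⟩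

instance : Zero (ArrowSet L) := ⟨⊥⟩

theorem comp_mem_mul {A B : ArrowSet L} {x y z : X} {f : L x ⟶ L y} {g : L y ⟶ L z}
    (hf : f ∈ B x y) (hg : g ∈ A y z) : f ≫ g ∈ (A * B) x z := ⟨y, f, hf, g, hg, rfl⟩

theorem id_mem_one (x : X) : 𝟙 (L x) ∈ (1 : ArrowSet L) x x := ⟨rfl, rfl⟩

theorem mem_inv {A : ArrowSet L} {x y : X} {f : L x ⟶ L y} :
    f ∈ (A⁻¹) x y ↔ Groupoid.inv f ∈ A y x := Iff.rfl

theorem inv_mem_inv {A : ArrowSet L} {x y : X} {f : L x ⟶ L y} :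
    Groupoid.inv f ∈ (A⁻¹) y x ↔ f ∈ A x y := by
  rw [mem_inv, Groupoid.inv_eq_inv, Groupoid.inv_eq_inv, IsIso.inv_inv]

instance : MonoidWithZero (ArrowSet L) where
  mul_assoc A B C := by
    ext x z h
    constructor
    · rintro ⟨y, f, hf, _, ⟨w, g, hg, k, hk, rfl⟩, rfl⟩
      exact ⟨w, _, comp_mem_mul hf hg, k, hk, Category.assoc _ _ _⟩
    · rintro ⟨y, _, ⟨w, g, hg, k, hk, rfl⟩, f, hf, rfl⟩
      exact ⟨w, g, hg, _, comp_mem_mul hk hf, (Category.assoc _ _ _).symm⟩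
  one_mul A := by
    ext x z h
    constructor
    · rintro ⟨y, f, hf, _, ⟨rfl, rfl⟩, rfl⟩
      simpa using hf
    · intro hh
      exact ⟨z, h, hh, _, id_mem_one z, Category.comp_id _⟩
  mul_one A := by
    ext x z h
    constructor
    · rintro ⟨y, _, ⟨rfl, rfl⟩, f, hf, rfl⟩
      simpa using hf
    · intro hh
      exact ⟨x, _, id_mem_one x, h, hh, Category.id_comp _⟩
  zero_mul A := by
    ext x z h
    constructor
    · rintro ⟨y, f, hf, g, hg, rfl⟩
      exact (notMem_bot g hg).elim
    · exact fun hh => (notMem_bot h hh).elim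
  mul_zero A := by
    ext x z h
    constructor
    · rintro ⟨y, f, hf, g, hg, rfl⟩
      exact (notMem_bot f hf).elim
    · exact fun hh => (notMem_bot h hh).elim

theorem mul_mono {A A' B B' : ArrowSet L} (h : A ≤ A') (h' : B ≤ B') : A * B ≤ A' * B' := by
  rintro x z _ ⟨y, f, hf, g, hg, rfl⟩
  exact comp_mem_mul (h' _ _ hf) (h _ _ hg)

protected theorem sup_mul (A B C : ArrowSet L) : (A ⊔ B) * C = A * C ⊔ B * C := by
  apply le_antisymm
  · rintro x z _ ⟨y, f, hf, g, hg | hg, rfl⟩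
    exacts [Or.inl (comp_mem_mul hf hg), Or.inr (comp_mem_mul hf hg)]
  · exact sup_le (mul_mono le_sup_left le_rfl) (mul_mono le_sup_right le_rfl)

protected theorem mul_sup (A B C : ArrowSet L) : A * (B ⊔ C) = A * B ⊔ A * C := by
  apply le_antisymm
  · rintro x z _ ⟨y, f, hf | hf, g, hg, rfl⟩
    exacts [Or.inl (comp_mem_mul hf hg), Or.inr (comp_mem_mul hf hg)]
  · exact sup_le (mul_mono le_rfl le_sup_left) (mul_mono le_rfl le_sup_right)

protected theorem inv_inv (A : ArrowSet L) : A⁻¹⁻¹ = A := by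
  ext x y f
  rw [mem_inv, inv_mem_inv]

theorem inv_mono {A B : ArrowSet L} (h : A ≤ B) : A⁻¹ ≤ B⁻¹ := fun _ _ _ hf => h _ _ hf

protected theorem mul_inv_rev (A B : ArrowSet L) : (A * B)⁻¹ = B⁻¹ * A⁻¹ := by
  ext x z h
  constructor
  · rintro ⟨y, f, hf, g, hg, e⟩
    refine ⟨y, Groupoid.inv g, inv_mem_inv.2 hg, Groupoid.inv f, inv_mem_inv.2 hf, ?_⟩
    simp only [Groupoid.inv_eq_inv] at e ⊢
    simp only [← IsIso.inv_comp, e, IsIso.inv_inv]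
  · rintro ⟨y, f, hf, g, hg, rfl⟩
    refine ⟨y, Groupoid.inv g, hg, Groupoid.inv f, hf, ?_⟩
    simp

protected theorem inv_one : (1 : ArrowSet L)⁻¹ = 1 := by
  have h : (1 : ArrowSet L)⁻¹ ≤ 1 := by
    rintro x y f ⟨rfl, h⟩
    refine ⟨rfl, ?_⟩
    rw [Groupoid.inv_eq_inv] at h
    have h' : f = inv (eqToHom rfl) := by simp only [← h, IsIso.inv_inv]
    rw [h']
    simp
  refine le_antisymm h ?_
  have := inv_mono h
  rwa [ArrowSet.inv_inv] at this

theorem inv_sup (A B : ArrowSet L) : (A ⊔ B)⁻¹ = A⁻¹ ⊔ B⁻¹ := rfl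

theorem le_mul_inv_mul (A : ArrowSet L) : A ≤ A * A⁻¹ * A := by
  intro x y f hf
  exact ⟨y, f, hf, _, comp_mem_mul (inv_mem_inv.2 hf) hf, by simp⟩

theorem mul_le_of_le_one_left {A B : ArrowSet L} (h : A ≤ 1) : A * B ≤ B := by
  simpa using mul_mono h (le_refl B)

theorem mul_le_of_le_one_right {A B : ArrowSet L} (h : B ≤ 1) : A * B ≤ A := by
  simpa using mul_mono (le_refl A) h

/-- `A` is a bisection: every object is the source and the target of at most one arrow. -/
structure IsBisection (A : ArrowSet L) : Prop where
  mul_inv_le : A * A⁻¹ ≤ 1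
  inv_mul_le : A⁻¹ * A ≤ 1

theorem IsBisection.one : IsBisection (1 : ArrowSet L) := by
  constructor <;> simp [ArrowSet.inv_one]

theorem IsBisection.zero : IsBisection (0 : ArrowSet L) := by
  constructor <;> simp <;> exact bot_le

theorem IsBisection.inv {A : ArrowSet L} (h : IsBisection A) : IsBisection A⁻¹ where
  mul_inv_le := by rw [ArrowSet.inv_inv]; exact h.inv_mul_le
  inv_mul_le := by rw [ArrowSet.inv_inv]; exact h.mul_inv_le

theorem IsBisection.mul {A B : ArrowSet L} (hA : IsBisection A) (hB : IsBisection B) :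
    IsBisection (A * B) where
  mul_inv_le := by
    rw [ArrowSet.mul_inv_rev, mul_assoc, ← mul_assoc B]
    exact (mul_mono le_rfl (mul_le_of_le_one_left hB.mul_inv_le)).trans hA.mul_inv_le
  inv_mul_le := by
    rw [ArrowSet.mul_inv_rev, mul_assoc, ← mul_assoc A⁻¹]
    exact (mul_mono le_rfl (mul_le_of_le_one_left hA.inv_mul_le)).trans hB.inv_mul_le

theorem IsBisection.sup {A B : ArrowSet L} (hA : IsBisection A) (hB : IsBisection B)
    (h : A⁻¹ * B ≤ 1) (h' : A * B⁻¹ ≤ 1) : IsBisection (A ⊔ B) := by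
  have k := inv_mono h
  have k' := inv_mono h'
  rw [ArrowSet.mul_inv_rev, ArrowSet.inv_inv, ArrowSet.inv_one] at k k'
  constructor
  · rw [inv_sup, ArrowSet.sup_mul, ArrowSet.mul_sup, ArrowSet.mul_sup]
    exact sup_le (sup_le hA.mul_inv_le h') (sup_le k' hB.mul_inv_le)
  · rw [inv_sup, ArrowSet.sup_mul, ArrowSet.mul_sup, ArrowSet.mul_sup]
    exact sup_le (sup_le hA.inv_mul_le h) (sup_le k hB.inv_mul_le)

theorem IsBisection.mul_inv_mul {A : ArrowSet L} (h : IsBisection A) : A * A⁻¹ * A = A :=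
  le_antisymm (mul_le_of_le_one_left h.mul_inv_le) (le_mul_inv_mul A)

/-- `AA⁻¹ = A(AA⁻¹) ≤ A`; inverting, `AA⁻¹ ≤ A⁻¹`, so `A = AA⁻¹A ≤ A⁻¹A ≤ 1`. -/
theorem IsBisection.le_one_of_mul_self {A : ArrowSet L} (h : IsBisection A) (hA : A * A = A) :
    A ≤ 1 := by
  have h1 : A * A⁻¹ ≤ A := by
    nth_rewrite 1 [← hA]
    rw [mul_assoc]
    exact mul_le_of_le_one_right h.mul_inv_le
  have h2 := inv_mono h1
  rw [ArrowSet.mul_inv_rev, ArrowSet.inv_inv] at h2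
  calc A = A * A⁻¹ * A := h.mul_inv_mul.symm
    _ ≤ A⁻¹ * A := mul_mono h2 le_rfl
    _ ≤ 1 := h.inv_mul_le

theorem mul_self_of_le_one {A : ArrowSet L} (hA : A ≤ 1) : A * A = A := by
  refine le_antisymm (mul_le_of_le_one_left hA) ((le_mul_inv_mul A).trans (mul_mono ?_ le_rfl))
  apply mul_le_of_le_one_right
  rw [← ArrowSet.inv_one]
  exact inv_mono hA

end ArrowSet

/-- A family of arrow sets that is closed under the operations of `ArrowSet`. -/
structure ArrowFamily (L : X → D) where
  carrier : Set (ArrowSet L)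
  one_mem : 1 ∈ carrier
  zero_mem : 0 ∈ carrier
  mul_mem : ∀ {A B}, A ∈ carrier → B ∈ carrier → A * B ∈ carrier
  inv_mem : ∀ {A}, A ∈ carrier → A⁻¹ ∈ carrier
  sup_mem : ∀ {A B}, A ∈ carrier → B ∈ carrier → A ⊔ B ∈ carrier

variable {L : X → D}

/-- The bisections that belong to the family `K`. -/
def Bisection (K : ArrowFamily L) := {A : ArrowSet L // A ∈ K.carrier ∧ A.IsBisection}

namespace Bisection

open ArrowSet

variable {K : ArrowFamily L}

theorem ext {a b : Bisection K} (h : a.1 = b.1) : a = b := Subtype.ext h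

instance : Inv (Bisection K) := ⟨fun a => ⟨a.1⁻¹, K.inv_mem a.2.1, a.2.2.inv⟩⟩

instance : MonoidWithZero (Bisection K) where
  mul a b := ⟨a.1 * b.1, K.mul_mem a.2.1 b.2.1, a.2.2.mul b.2.2⟩
  one := ⟨1, K.one_mem, .one⟩
  zero := ⟨0, K.zero_mem, .zero⟩
  mul_assoc _ _ _ := ext (mul_assoc _ _ _)
  one_mul _ := ext (one_mul _)
  mul_one _ := ext (mul_one _)
  zero_mul _ := ext (zero_mul _)
  mul_zero _ := ext (mul_zero _)

theorem val_mul (a b : Bisection K) : (a * b).1 = a.1 * b.1 := rfl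

theorem isIdempotentElem_iff {a : Bisection K} : IsIdempotentElem a ↔ a.1 ≤ 1 :=
  ⟨fun h => a.2.2.le_one_of_mul_self (congrArg Subtype.val h),
    fun h => ext (mul_self_of_le_one h)⟩

instance : InverseMonoid (Bisection K) where
  mul_inv_mul a := ext a.2.2.mul_inv_mul
  inv_mul_inv a := ext (by
    have := a.2.2.inv.mul_inv_mul
    rwa [ArrowSet.inv_inv] at this)
  inv_unique a b h h' := by
    -- Both `ab` and `ba` are idempotent, hence below `1`, so `b = (ba)a⁻¹(ab) ≤ a⁻¹`; the converse
    -- is similar.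
    have hab : (a * b).1 ≤ 1 := isIdempotentElem_iff.1 (by
      rw [IsIdempotentElem, ← mul_assoc, h])
    have hba : (b * a).1 ≤ 1 := isIdempotentElem_iff.1 (by
      rw [IsIdempotentElem, ← mul_assoc, h'])
    rw [val_mul] at hab hba
    have ha := a.2.2.mul_inv_mul
    have ha' := a.2.2.inv.mul_inv_mul
    rw [ArrowSet.inv_inv] at ha'
    replace h : a.1 * b.1 * a.1 = a.1 := congrArg Subtype.val h
    replace h' : b.1 * a.1 * b.1 = b.1 := congrArg Subtype.val h'
    apply ext
    apply le_antisymm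
    · calc b.1 = b.1 * a.1 * a.1⁻¹ * (a.1 * b.1) := by
            simp only [mul_assoc] at *
            rw [← mul_assoc a.1, ← mul_assoc (a.1 * _), mul_assoc a.1, ha, h']
        _ ≤ a.1⁻¹ := (mul_le_of_le_one_right hab).trans (mul_le_of_le_one_left hba)
    · calc a.1⁻¹ = a.1⁻¹ * a.1 * b.1 * (a.1 * a.1⁻¹) := by
            simp only [mul_assoc] at *
            rw [← mul_assoc b.1, ← mul_assoc a.1, h, ha']
        _ ≤ b.1 := (mul_le_of_le_one_right a.2.2.mul_inv_le).trans
            (mul_le_of_le_one_left a.2.2.inv_mul_le)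

/-- With the order reduced to inclusion, compatible joins are unions, over which multiplication
distributes. -/
theorem invLE_iff {a b : Bisection K} : InvLE a b ↔ a.1 ≤ b.1 := by
  constructor
  · intro h
    have h' : a.1 = b.1 * (a.1⁻¹ * a.1) := congrArg Subtype.val h
    rw [h']
    exact mul_le_of_le_one_right a.2.2.inv_mul_le
  · intro h
    apply ext
    change a.1 = b.1 * (a.1⁻¹ * a.1)
    rw [← mul_assoc]
    refine le_antisymm ((le_mul_inv_mul _).trans (mul_mono (mul_mono h le_rfl) le_rfl)) ?_
    exact (mul_mono (mul_mono le_rfl (inv_mono h)) le_rfl).trans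
      (mul_le_of_le_one_left b.2.2.mul_inv_le)

theorem isJoin_of_eq_sup {a b j : Bisection K} (h : j.1 = a.1 ⊔ b.1) :
    IsJoin InvLE {a, b} j := by
  constructor
  · rintro c (rfl | rfl) <;> rw [invLE_iff, h]
    exacts [le_sup_left, le_sup_right]
  · intro u hu
    rw [invLE_iff, h]
    exact sup_le (invLE_iff.1 (hu a (Or.inl rfl))) (invLE_iff.1 (hu b (Or.inr rfl)))

theorem exists_eq_sup {a b : Bisection K} (h : InvCompatible a b) :
    ∃ j : Bisection K, j.1 = a.1 ⊔ b.1 :=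
  ⟨⟨a.1 ⊔ b.1, K.sup_mem a.2.1 b.2.1,
    a.2.2.sup b.2.2 (isIdempotentElem_iff.1 h.1) (isIdempotentElem_iff.1 h.2)⟩, rfl⟩

theorem eq_sup_of_isJoin {a b j : Bisection K} (h : InvCompatible a b)
    (hj : IsJoin InvLE {a, b} j) : j.1 = a.1 ⊔ b.1 := by
  obtain ⟨k, hk⟩ := exists_eq_sup h
  rw [← hk, hj.unique (fun a b h h' => ext (le_antisymm (invLE_iff.1 h) (invLE_iff.1 h')))
    (isJoin_of_eq_sup hk)]

/-- The bisections in a family form a Boolean inverse monoid if the idempotents among them form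
a Boolean algebra. -/
abbrev booleanInverseMonoid
    (h : ∃ B : BooleanAlgebra {e : Bisection K // IsIdempotentElem e},
      ∀ e f : {e : Bisection K // IsIdempotentElem e}, B.le e f ↔ InvLE (e : Bisection K) f) :
    BooleanInverseMonoid (Bisection K) where
  __ := (inferInstance : InverseMonoid (Bisection K))
  __ := (inferInstance : MonoidWithZero (Bisection K))
  exists_join a b h := (exists_eq_sup h).imp fun _ => isJoin_of_eq_sup
  mul_join c a b j h hj := isJoin_of_eq_sup (by
    rw [val_mul, eq_sup_of_isJoin h hj, ArrowSet.mul_sup, val_mul, val_mul])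
  join_mul c a b j h hj := isJoin_of_eq_sup (by
    rw [val_mul, eq_sup_of_isJoin h hj, ArrowSet.sup_mul, val_mul, val_mul])
  idempotents_boolean := h

end Bisection

end ArrowSet

namespace Point

/-! ### Sets of germs, fractions and compactness. -/

section Slice

variable {S D : Type u} [BooleanRestrictionMonoid S] [Groupoid.{u} D] (L : Point S ⥤ D)

/-- The set of all germs of `s`. -/
def slice (s : S) : ArrowSet L.obj := fun x y => {f | ∃ h : Maps s x y, f = L.map (germ s h)}

theorem map_germ_mem_slice {s : S} {x y : Point S} (h : Maps s x y) :
    L.map (germ s h) ∈ slice L s x y := ⟨h, rfl⟩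

theorem slice_mul (s t : S) : slice L (s * t) = slice L s * slice L t := by
  ext x z f
  constructor
  · rintro ⟨h, rfl⟩
    have ht : Maps t x _ := maps_act (x.mem_of_mul_mem h.mem)
    have hs : Maps s (act t x ht.mem) z := fun u => by rw [h u, mem_act, mul_assoc]
    refine ⟨_, _, map_germ_mem_slice L ht, _, map_germ_mem_slice L hs, ?_⟩
    rw [← L.map_comp, germ_comp_germ]
  · rintro ⟨y, _, ⟨ht, rfl⟩, _, ⟨hs, rfl⟩, rfl⟩
    exact ⟨ht.comp hs, by rw [← L.map_comp, germ_comp_germ]⟩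

theorem mem_slice_proj {e : S} (he : IsProj e) {x y : Point S} {f : L.obj x ⟶ L.obj y} :
    f ∈ slice L e x y ↔ e ∈ x ∧ f ∈ (1 : ArrowSet L.obj) x y := by
  constructor
  · rintro ⟨h, rfl⟩
    obtain ⟨hx, rfl⟩ := (maps_proj_iff he).1 h
    refine ⟨hx, rfl, ?_⟩
    rw [germ_proj he, L.map_id]
    rfl
  · rintro ⟨h, rfl, rfl⟩
    refine ⟨(maps_proj_iff he).2 ⟨h, rfl⟩, ?_⟩
    rw [germ_proj he, L.map_id]
    rfl

theorem slice_one : slice L 1 = 1 := by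
  ext x y f
  rw [mem_slice_proj L isProj_one]
  simp [x.one_mem]

theorem slice_zero : slice L 0 = 0 := by
  ext x y f
  rw [mem_slice_proj L isProj_zero]
  simp only [x.zero_notMem, false_and, false_iff]
  exact ArrowSet.notMem_bot f

theorem slice_le_one {e : S} (he : IsProj e) : slice L e ≤ 1 :=
  fun _ _ _ h => ((mem_slice_proj L he).1 h).2

theorem slice_join {e f g : S} (he : IsProj e) (hf : IsProj f) (hg : IsJoin NatLE {e, f} g) :
    slice L g = slice L e ⊔ slice L f := by
  ext x y k
  rw [ArrowSet.mem_sup, mem_slice_proj L he, mem_slice_proj L hf,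
    mem_slice_proj L (he.isProj_join hf hg), ← or_and_right]
  have : g ∈ x ↔ e ∈ x ∨ f ∈ x :=
    ⟨x.mem_or_mem he hf hg, fun h => h.elim (x.mem_of_natLE hg.left) (x.mem_of_natLE hg.right)⟩
  rw [this]

/-- Germs of `s` with a common target have a common source by `Maps.injective`, so only identities
survive. -/
theorem slice_inv_mul (s : S) : (slice L s)⁻¹ * slice L s = slice L (rproj s) := by
  ext x z f
  rw [mem_slice_proj L (isProj_rproj s), x.rproj_mem_iff]
  constructor
  · rintro ⟨y, _, ⟨h, rfl⟩, g, ⟨h', hg⟩, rfl⟩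
    obtain rfl := h.injective h'
    refine ⟨h.mem, rfl, ?_⟩
    rw [← hg]
    simp
  · rintro ⟨h, rfl, rfl⟩
    refine ⟨_, _, map_germ_mem_slice L (maps_act h), _,
      ArrowSet.inv_mem_inv.2 (map_germ_mem_slice L (maps_act h)), ?_⟩
    simp

theorem slice_mul_inv (s : S) : slice L s * (slice L s)⁻¹ = slice L (lproj s) := by
  ext x z f
  rw [mem_slice_proj L (isProj_lproj s)]
  constructor
  · rintro ⟨y, g, ⟨h, hg⟩, _, ⟨h', rfl⟩, rfl⟩
    obtain rfl := h.unique h'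
    refine ⟨h.lproj_mem, rfl, ?_⟩
    rw [← hg]
    simp
  · rintro ⟨h, rfl, rfl⟩
    refine ⟨_, _, ArrowSet.inv_mem_inv.2 (map_germ_mem_slice L (maps_coact h)), _,
      map_germ_mem_slice L (maps_coact h), ?_⟩
    simp

theorem isBisection_slice (s : S) : (slice L s).IsBisection where
  mul_inv_le := by
    rw [slice_mul_inv]
    exact slice_le_one L (isProj_lproj s)
  inv_mul_le := by
    rw [slice_inv_mul]
    exact slice_le_one L (isProj_rproj s)

theorem slice_proj_inv {e : S} (he : IsProj e) : (slice L e)⁻¹ = slice L e := by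
  have h1 := slice_inv_mul L e
  have h2 := congrArg (· ⁻¹) h1
  simp only [ArrowSet.mul_inv_rev, ArrowSet.inv_inv] at h2
  rw [h1, he.rproj_eq] at h2
  exact h2.symm

theorem slice_proj_mul_slice_inv (s : S) {e : S} (he : IsProj e) :
    slice L e * (slice L s)⁻¹ = (slice L (s * e))⁻¹ := by
  rw [slice_mul, ArrowSet.mul_inv_rev, slice_proj_inv L he]

/-- The set of all germs of formal fractions `s⁻¹ t`. -/
def fraction (p : S × S) : ArrowSet L.obj := (slice L p.1)⁻¹ * slice L p.2

/-- `A` is a union of finitely many sets of germs of fractions. -/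
def IsFiniteUnion (A : ArrowSet L.obj) : Prop := ∃ P : Finset (S × S), A = P.sup (fraction L)

variable {L}

theorem isFiniteUnion_fraction (p : S × S) : IsFiniteUnion L (fraction L p) :=
  ⟨{p}, Finset.sup_singleton.symm⟩

theorem isFiniteUnion_slice (s : S) : IsFiniteUnion L (slice L s) := by
  have := isFiniteUnion_fraction (L := L) (1, s)
  rwa [fraction, slice_one, ArrowSet.inv_one, one_mul] at this

theorem isFiniteUnion_zero : IsFiniteUnion L 0 := ⟨∅, Finset.sup_empty.symm⟩

theorem IsFiniteUnion.sup {A B : ArrowSet L.obj} (hA : IsFiniteUnion L A)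
    (hB : IsFiniteUnion L B) : IsFiniteUnion L (A ⊔ B) := by
  classical
  obtain ⟨P, rfl⟩ := hA
  obtain ⟨Q, rfl⟩ := hB
  exact ⟨P ∪ Q, Finset.sup_union.symm⟩

theorem IsFiniteUnion.induction {motive : ArrowSet L.obj → Prop} (zero : motive 0)
    (sup : ∀ A B, motive A → motive B → motive (A ⊔ B)) (fraction : ∀ p, motive (fraction L p))
    {A : ArrowSet L.obj} (hA : IsFiniteUnion L A) : motive A := by
  obtain ⟨P, rfl⟩ := hA
  exact Finset.sup_induction zero (fun A hA B hB => sup A B hA hB) fun p _ => fraction p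

theorem IsFiniteUnion.inv {A : ArrowSet L.obj} (hA : IsFiniteUnion L A) :
    IsFiniteUnion L A⁻¹ := by
  refine hA.induction (motive := fun A => IsFiniteUnion L A⁻¹) isFiniteUnion_zero
    (fun A B hA hB => hA.sup hB) fun p => ?_
  rw [fraction, ArrowSet.mul_inv_rev, ArrowSet.inv_inv]
  exact isFiniteUnion_fraction (p.2, p.1)

theorem IsFiniteUnion.mul_slice {A : ArrowSet L.obj} (hA : IsFiniteUnion L A) (s : S) :
    IsFiniteUnion L (A * slice L s) := by
  refine hA.induction (motive := fun A => IsFiniteUnion L (A * slice L s)) ?_ ?_ fun p => ?_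
  · rw [zero_mul]
    exact isFiniteUnion_zero
  · intro A B hA hB
    rw [ArrowSet.sup_mul]
    exact hA.sup hB
  · rw [fraction, mul_assoc, ← slice_mul]
    exact isFiniteUnion_fraction (p.1, p.2 * s)

theorem IsFiniteUnion.slice_inv_mul {A : ArrowSet L.obj} (hA : IsFiniteUnion L A) (s : S) :
    IsFiniteUnion L ((slice L s)⁻¹ * A) := by
  have := (hA.inv.mul_slice s).inv
  rwa [ArrowSet.mul_inv_rev, ArrowSet.inv_inv] at this

/-- On `e`, where `p` is defined after `b`: `bc⁻¹ = p⁻¹(pb)c⁻¹ = p⁻¹q(cc⁻¹)`, and `cc⁻¹` is a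
projection. -/
theorem slice_mul_slice_inv_eq_fraction {b c p q e : S} (he : IsProj e)
    (h : p * b * e = q * c * e) (hp : rproj (p * b) * e = e) :
    slice L (b * e) * (slice L c)⁻¹ = fraction L (p, q * lproj (c * e)) := by
  have h1 : rproj p * (b * e) = b * e := by
    rw [← mul_assoc, RestrictionMonoid.rproj_mul_eq, mul_assoc, hp]
  change _ = (slice L p)⁻¹ * slice L (q * lproj (c * e))
  calc slice L (b * e) * (slice L c)⁻¹
      = slice L (b * e) * (slice L (c * e))⁻¹ := by
        rw [← slice_proj_mul_slice_inv L c he, ← mul_assoc, ← slice_mul, mul_assoc b, he.mul_self]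
    _ = (slice L p)⁻¹ * slice L (p * (b * e)) * (slice L (c * e))⁻¹ := by
        rw [slice_mul L p, ← mul_assoc _ (slice L p), slice_inv_mul, ← slice_mul, h1]
    _ = (slice L p)⁻¹ * slice L (q * lproj (c * e)) := by
        rw [← mul_assoc, h, mul_assoc q, slice_mul L q, mul_assoc, mul_assoc, slice_mul_inv,
          ← slice_mul]

/-- Only `b*c*` matters. Near each of its points the Ore condition gives `pb = qc`, so `bc⁻¹` is a
single fraction there; compactness leaves finitely many. -/
theorem isFiniteUnion_slice_mul_slice_inv
    (hore : ∀ {x y z : Point S} (f : x ⟶ y) (g : x ⟶ z),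
      ∃ (w : Point S) (p : y ⟶ w) (q : z ⟶ w), f ≫ p = g ≫ q) (b c : S) :
    IsFiniteUnion L (slice L b * (slice L c)⁻¹) := by
  suffices h : IsFiniteUnion L (slice L (b * (rproj b * rproj c)) * (slice L c)⁻¹) by
    rwa [← mul_assoc, RestrictionMonoid.mul_rproj_self, slice_mul, mul_assoc,
      slice_proj_mul_slice_inv L _ (isProj_rproj c), RestrictionMonoid.mul_rproj_self] at h
  refine induction_of_local (fun e => IsFiniteUnion L (slice L (b * e) * (slice L c)⁻¹))
    ?_ ?_ ?_ ((isProj_rproj b).mul (isProj_rproj c)) ?_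
  · rw [mul_zero, slice_zero, zero_mul]
    exact isFiniteUnion_zero
  · intro e f he hf h
    -- Restricting to `f` on the right of `c⁻¹`: `fc⁻¹ = (cf)⁻¹ = c⁻¹(cf)⁺`.
    have := h.mul_slice (lproj (c * f))
    rwa [mul_assoc, ← slice_proj_inv L (isProj_lproj (c * f)), ← ArrowSet.mul_inv_rev,
      ← slice_mul, ← mul_proj c hf, ← slice_proj_mul_slice_inv L c hf, ← mul_assoc, ← slice_mul,
      mul_assoc] at this
  · intro e f g he hf hg h h'
    rw [slice_mul, slice_join L he hf hg, ArrowSet.mul_sup, ← slice_mul, ← slice_mul,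
      ArrowSet.sup_mul]
    exact h.sup h'
  · intro x hx
    rw [x.mul_mem_iff (isProj_rproj c), x.rproj_mem_iff, x.rproj_mem_iff] at hx
    obtain ⟨w, p', q', h⟩ := hore (germ b (maps_act hx.1)) (germ c (maps_act hx.2))
    obtain ⟨p, hp, rfl⟩ := exists_eq_germ p'
    obtain ⟨q, hq, rfl⟩ := exists_eq_germ q'
    rw [germ_comp_germ, germ_comp_germ, germ_eq_iff] at h
    obtain ⟨k, hkx, hk, h⟩ := h
    have hpb := isProj_rproj (p * b)
    -- The factor `(pb)*` ensures that `pb` is defined on the whole neighbourhood.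
    refine ⟨k * rproj (p * b), hk.mul hpb,
      (x.mul_mem_iff hpb).2 ⟨hkx, x.rproj_mem_iff.2 ((maps_act hx.1).comp hp).mem⟩, ?_⟩
    rw [slice_mul_slice_inv_eq_fraction (p := p) (q := q) (hk.mul hpb)]
    · exact isFiniteUnion_fraction _
    · rw [← mul_assoc, h, mul_assoc]
    · rw [hk.comm hpb, ← mul_assoc, hpb.mul_self]

/-- In `(s⁻¹t)(u⁻¹v)` only the middle part `tu⁻¹` has to be rewritten. -/
theorem IsFiniteUnion.mul
    (hore : ∀ {x y z : Point S} (f : x ⟶ y) (g : x ⟶ z),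
      ∃ (w : Point S) (p : y ⟶ w) (q : z ⟶ w), f ≫ p = g ≫ q)
    {A B : ArrowSet L.obj} (hA : IsFiniteUnion L A) (hB : IsFiniteUnion L B) :
    IsFiniteUnion L (A * B) := by
  refine hB.induction (motive := fun B => IsFiniteUnion L (A * B)) ?_ ?_ fun q => ?_
  · rw [mul_zero]
    exact isFiniteUnion_zero
  · intro B C hB hC
    rw [ArrowSet.mul_sup]
    exact hB.sup hC
  rw [fraction, ← mul_assoc]
  refine IsFiniteUnion.mul_slice ?_ _
  refine hA.induction (motive := fun A => IsFiniteUnion L (A * (slice L q.1)⁻¹)) ?_ ?_ fun p => ?_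
  · rw [zero_mul]
    exact isFiniteUnion_zero
  · intro B C hB hC
    rw [ArrowSet.sup_mul]
    exact hB.sup hC
  rw [fraction, mul_assoc]
  exact (isFiniteUnion_slice_mul_slice_inv hore _ _).slice_inv_mul _

variable (L) in
/-- The family of all finite unions of sets of germs of fractions. -/
def fractionFamily
    (hore : ∀ {x y z : Point S} (f : x ⟶ y) (g : x ⟶ z),
      ∃ (w : Point S) (p : y ⟶ w) (q : z ⟶ w), f ≫ p = g ≫ q) : ArrowFamily L.obj where
  carrier := {A | IsFiniteUnion L A}
  one_mem := by
    rw [← slice_one]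
    exact isFiniteUnion_slice 1
  zero_mem := isFiniteUnion_zero
  mul_mem := IsFiniteUnion.mul hore
  inv_mem := IsFiniteUnion.inv
  sup_mem := IsFiniteUnion.sup

theorem mul_eq_mul_of_local {a b e : S} (he : IsProj e)
    (h : ∀ x : Point S, e ∈ x → GermEq x a b) : a * e = b * e := by
  refine induction_of_local (fun e => a * e = b * e) ?_ ?_ ?_ he ?_
  · rw [mul_zero, mul_zero]
  · intro e f _ _ h
    rw [← mul_assoc, h, mul_assoc]
  · intro e f g he hf hg h h'
    have h1 := he.mul_join hf hg a
    rw [h, h'] at h1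
    exact h1.unique (fun _ _ => NatLE.antisymm) (he.mul_join hf hg b)
  · intro x hx
    obtain ⟨f, hfx, hf, h⟩ := h x hx
    exact ⟨f, hf, hfx, h⟩

theorem natLE_of_slice_le
    (hL : ∀ {x y : Point S} (f g : x ⟶ y), L.map f = L.map g → f = g) {a b : S}
    (h : slice L a ≤ slice L b) : NatLE a b := by
  rw [NatLE, ← mul_eq_mul_of_local (isProj_rproj a), RestrictionMonoid.mul_rproj_self]
  intro x hx
  obtain ⟨hb, hg⟩ := h _ _ (map_germ_mem_slice L (maps_act (x.rproj_mem_iff.1 hx)))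
  exact (germ_eq_iff _ _).1 (hL _ _ hg)

theorem slice_le_slice_of_natLE {a b : S} (h : NatLE a b) : slice L a ≤ slice L b := by
  rw [show a = b * rproj a from h, slice_mul]
  exact ArrowSet.mul_le_of_le_one_right (slice_le_one L (isProj_rproj a))

/-- Put `e = (p⁺q)*`. At each point of `e`, `p⁻¹q` contains an arrow, an identity by assumption, so
`p` and `q` have the same germ. Hence `pe = qe`, and `p⁻¹q = p⁻¹pe = p*e`. -/
theorem exists_fraction_eq_slice
    (hL : ∀ {x y : Point S} (f g : x ⟶ y), L.map f = L.map g → f = g) {p : S × S}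
    (h : fraction L p ≤ 1) : ∃ e, IsProj e ∧ fraction L p = slice L e := by
  obtain ⟨p, q⟩ := p
  have he := isProj_rproj (lproj p * q)
  have key : p * rproj (lproj p * q) = q * rproj (lproj p * q) := by
    refine mul_eq_mul_of_local he fun x hx => ?_
    rw [x.rproj_mem_iff] at hx
    have hq : q ∈ x := x.mem_of_mul_mem hx
    -- Since `p⁺q ∈ x`, the target of `q` at `x` contains `p⁺` and so has a preimage under `p`.
    obtain ⟨x', hp⟩ : ∃ x', Maps p x' (act q x hq) := ⟨_, maps_coact (y := act q x hq) hx⟩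
    obtain ⟨rfl, hg⟩ := h _ _ (ArrowSet.comp_mem_mul (map_germ_mem_slice L (maps_act hq))
      (ArrowSet.inv_mem_inv.2 (map_germ_mem_slice L hp)))
    rw [← germ_eq_iff hp (maps_act hq)]
    apply hL
    rw [Groupoid.inv_eq_inv, IsIso.comp_inv_eq, eqToHom_refl, Category.id_comp] at hg
    exact hg.symm
  refine ⟨rproj p * rproj (lproj p * q), (isProj_rproj p).mul he, ?_⟩
  calc (slice L p)⁻¹ * slice L q = (slice L p)⁻¹ * slice L (lproj p * q) := by
        rw [slice_mul, ← slice_mul_inv, ← mul_assoc, ← mul_assoc]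
        have := (isBisection_slice L p).inv.mul_inv_mul
        rw [ArrowSet.inv_inv] at this
        rw [this]
    _ = (slice L p)⁻¹ * slice L (p * rproj (lproj p * q)) :=
        congrArg (fun s => (slice L p)⁻¹ * slice L s)
          ((proj_mul q (isProj_lproj p)).trans key.symm)
    _ = slice L (rproj p * rproj (lproj p * q)) := by
        rw [slice_mul, slice_mul, ← slice_inv_mul L p, mul_assoc]

theorem IsFiniteUnion.exists_eq_slice
    (hL : ∀ {x y : Point S} (f g : x ⟶ y), L.map f = L.map g → f = g) {A : ArrowSet L.obj}
    (hA : IsFiniteUnion L A) : A ≤ 1 → ∃ e, IsProj e ∧ A = slice L e := by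
  refine hA.induction (motive := fun A => A ≤ 1 → ∃ e, IsProj e ∧ A = slice L e) ?_ ?_
    fun p => exists_fraction_eq_slice hL
  · exact fun _ => ⟨0, isProj_zero, (slice_zero L).symm⟩
  · intro A B hA hB h
    obtain ⟨e, he, rfl⟩ := hA (le_sup_left.trans h)
    obtain ⟨f, hf, rfl⟩ := hB (le_sup_right.trans h)
    obtain ⟨g, hg, hj⟩ := he.exists_join hf
    exact ⟨g, hg, (slice_join L he hf hj).symm⟩

end Slice

/-! ### The embedding into the Boolean inverse monoid of bisections. -/

section Embedding

variable {S D : Type u} [BooleanRestrictionMonoid S] [Groupoid.{u} D] {L : Point S ⥤ D}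
  {K : ArrowFamily L.obj}

variable (L) in
/-- The homomorphism that sends an element to its set of germs. -/
def sliceHom (hK : ∀ A, IsFiniteUnion L A ↔ A ∈ K.carrier) : S →* Bisection K where
  toFun s := ⟨slice L s, (hK _).1 (isFiniteUnion_slice s), isBisection_slice L s⟩
  map_one' := Bisection.ext (slice_one L)
  map_mul' s t := Bisection.ext (slice_mul L s t)

theorem sliceHom_injective (hK : ∀ A, IsFiniteUnion L A ↔ A ∈ K.carrier)
    (hL : ∀ {x y : Point S} (f g : x ⟶ y), L.map f = L.map g → f = g) :
    Function.Injective (sliceHom L hK) := by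
  intro a b h
  have h' : slice L a = slice L b := congrArg Subtype.val h
  exact (natLE_of_slice_le hL h'.le).antisymm (natLE_of_slice_le hL h'.ge)

theorem exists_sliceHom_eq (hK : ∀ A, IsFiniteUnion L A ↔ A ∈ K.carrier)
    (hL : ∀ {x y : Point S} (f g : x ⟶ y), L.map f = L.map g → f = g) {t : Bisection K}
    (ht : IsIdempotentElem t) : ∃ e, IsProj e ∧ sliceHom L hK e = t := by
  obtain ⟨e, he, h⟩ := ((hK _).2 t.2.1).exists_eq_slice hL (Bisection.isIdempotentElem_iff.1 ht)
  exact ⟨e, he, Bisection.ext h.symm⟩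

/-- The projections of `S` and the idempotents of `T` are in order-preserving bijection, so the
Boolean structure is transported. -/
theorem exists_booleanAlgebra_idempotents (hK : ∀ A, IsFiniteUnion L A ↔ A ∈ K.carrier)
    (hL : ∀ {x y : Point S} (f g : x ⟶ y), L.map f = L.map g → f = g) :
    ∃ B : BooleanAlgebra {e : Bisection K // IsIdempotentElem e},
      ∀ e f : {e : Bisection K // IsIdempotentElem e}, B.le e f ↔ InvLE (e : Bisection K) f := by
  obtain ⟨B, hB⟩ := BooleanRestrictionMonoid.proj_boolean (S := S)
  let φ : Proj S → {e : Bisection K // IsIdempotentElem e} := fun e =>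
    ⟨sliceHom L hK e, by
      rw [IsIdempotentElem, ← map_mul, (isProj_of_mem_proj e.2).mul_self]⟩
  have hφ : Function.Bijective φ := by
    constructor
    · intro e f h
      exact Subtype.ext (sliceHom_injective hK hL (congrArg Subtype.val h))
    · rintro ⟨t, ht⟩
      obtain ⟨e, he, rfl⟩ := exists_sliceHom_eq hK hL ht
      exact ⟨⟨e, he.mem_proj⟩, rfl⟩
  let ψ := Equiv.ofBijective φ hφ
  refine ⟨ψ.symm.booleanAlgebra, fun e f => ?_⟩
  obtain ⟨e, rfl⟩ := ψ.surjective e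
  obtain ⟨f, rfl⟩ := ψ.surjective f
  change B.le (ψ.symm (ψ e)) (ψ.symm (ψ f)) ↔ _
  rw [ψ.symm_apply_apply, ψ.symm_apply_apply, hB, Bisection.invLE_iff]
  exact ⟨slice_le_slice_of_natLE, natLE_of_slice_le hL⟩

theorem exists_isJoin_fractions (hK : ∀ A, IsFiniteUnion L A ↔ A ∈ K.carrier)
    (t : Bisection K) : ∃ P : Finset (S × S),
      IsJoin InvLE {x | ∃ p ∈ P, x = (sliceHom L hK p.1)⁻¹ * sliceHom L hK p.2} t := by
  obtain ⟨P, hP⟩ := (hK _).2 t.2.1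
  refine ⟨P, ?_, fun u hu => ?_⟩
  · rintro _ ⟨p, hp, rfl⟩
    rw [Bisection.invLE_iff, hP]
    exact Finset.le_sup (f := fraction L) hp
  · rw [Bisection.invLE_iff, hP]
    exact Finset.sup_le fun p hp => Bisection.invLE_iff.1 (hu _ ⟨p, hp, rfl⟩)

end Embedding

end Point

end AmpleMonoid

theorem mainTheorem1 {S : Type u} [AmpleMonoid.BooleanAmpleMonoid S]
    (hC : AmpleMonoid.ConditionC S) :
    ∃ (T : Type u) (_ : AmpleMonoid.BooleanInverseMonoid T) (ι : S →* T),
      AmpleMonoid.IsFullEmbedding ι ∧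
      ∀ t : T, t ≠ 0 → ∃ P : Finset (S × S),
        AmpleMonoid.IsJoin AmpleMonoid.InvLE {x | ∃ p ∈ P, x = (ι p.1)⁻¹ * ι p.2} t := by
  open AmpleMonoid in
  obtain ⟨D, _, L, hL⟩ := exists_faithful_functor_groupoid (C := Point S)
    Point.mono_germ Point.epi_germ (Point.exists_comp_eq_comp hC)
  let K := Point.fractionFamily L (Point.exists_comp_eq_comp hC)
  have hK : ∀ A, Point.IsFiniteUnion L A ↔ A ∈ K.carrier := fun _ => Iff.rfl
  refine ⟨Bisection K, Bisection.booleanInverseMonoid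
    (Point.exists_booleanAlgebra_idempotents hK hL), Point.sliceHom L hK,
    ⟨Point.sliceHom_injective hK hL, fun e he => ?_⟩,
    fun t _ => Point.exists_isJoin_fractions hK t⟩
  obtain ⟨e, -, rfl⟩ := Point.exists_sliceHom_eq hK hL he
  exact ⟨e, rfl⟩
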